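/- An \emph{action operad} $\mathbf\Lambda$ is a non-symmetric operad $\Lambda=\{\Lambda(n)\}_{n\ge 0}$ in the category of sets in which each $\Lambda(n)$ is a group, together with group homomorphisms $\pi_n:\Lambda(n)\to\Sigma_n$ that form a map of operads to the operad of symmetric groups, such that the operad multiplication $\mu$ satisfies $$\mu(g;f_1,\dots,f_n)\,\mu(g';f'_1,\dots,f'_n)=\mu\big(gg';f_{\pi(g')(1)}f'_1,\dots,f_{\pi(g')(n)}f'_n\big)$$ whenever $g,g'\in\Lambda(n)$, $f'_i\in\Lambda(k_i)$ and $f_i\in\Lambda(k_{\pi(g')^{-1}(i)})$. Morphisms of action operads are operad maps that consist of group homomorphisms and commute with the maps to the symmetric groups; $\mathbf{AOp}$ is the resulting category. For a small category $X$ let $E\Sigma(X)=\coprod_n E\Sigma_n\times_{\Sigma_n}X^n$ be the category whose objects are the finite lists $(x_1,\dots,x_n)$ of objects of $X$, and whose morphisms $(x_1,\dots,x_n)\to(y_1,\dots,y_m)$ exist only if $n=m$ and consist of $\sigma\in\Sigma_n$ and morphisms $x_i\to y_{\sigma(i)}$; $E\Sigma$ is a cartesian monad on $\mathbf{Cat}$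 (the unit is given by one-element lists, the multiplication by concatenation), and $E\Sigma(1)=B\Sigma$. The category $\mathbf{Cat}/B\Sigma$ is monoidal under the composition product $X\circ Y = X\times_{E\Sigma(1)}E\Sigma(Y)$, with structure functor $X\circ Y\to E\Sigma(Y)\to E\Sigma(E\Sigma(1))\to E\Sigma(1)$ and unit $1\to E\Sigma(1)$. A \emph{club} is a monoid in this monoidal category, and morphisms of clubs are morphisms of monoids. For an action operad $\mathbf\Lambda$ let $K_{\mathbf\Lambda}$ be the club whose underlying category $B\mathbf\Lambda$ has the natural numbers as objects, $B\mathbf\Lambda(n,n)=\Lambda(n)$, and $B\mathbf\Lambda(m,n)=\varnothing$ for $m\neq n$, with the functor $B\pi:B\mathbf\Lambda\to B\Sigma$, the unit given by the object $1$, and the multiplication given by $(n;k_1,\dots,k_n)\mapsto k_1+\cdots+k_n$ on objects and by $\mu$ on morphisms. \textbf{Theorem.} Let $K$ be a club such that the functor $K\to B\Sigma$ is bijective on objects and $K$ is a groupoid. Then $K\cong K_{\mathbf\Lambda}$, as clubs, for some action operad $\mathbf\Lambda$. Moreover, the assignment $\mathbf\Lambda\mapsto K_{\mathbf\Lambda}$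 is a full and faithful functor from $\mathbf{AOp}$ to the category of clubs. -/

import Mathlib

open CategoryTheory

universe u

attribute [-instance] CategoryTheory.catToReflQuiver

/-! ## Action operads -/

/-- The lexicographic numbering of a double family of indices: `⟨i, j⟩ ↦ ∑_{i' < i} k i' + j`. -/
@[irreducible]
def sigmaFin {n : ℕ} {k : Fin n → ℕ} : (Σ i, Fin (k i)) ≃ Fin (∑ i, k i) := finSigmaFinEquiv

lemma sigmaFin_eq {n : ℕ} {k : Fin n → ℕ} : sigmaFin (k := k) = finSigmaFinEquiv := by
  unfold sigmaFin; rfl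

/-- Lexicographic concatenation of a family of families: the list
`z 0 0, z 0 1, …, z 1 0, …` obtained from the double list `z`. -/
def flattenFamily {A : Type*} {n : ℕ} {k : Fin n → ℕ} (z : ∀ i, Fin (k i) → A) :
    Fin (∑ i, k i) → A :=
  fun p => z (sigmaFin.symm p).1 (sigmaFin.symm p).2

/-- The dependent version of `flattenFamily`. -/
def flattenDep {A : Type*} {B : A → Type*} {n : ℕ} {k : Fin n → ℕ} {z : ∀ i, Fin (k i) → A}
    (h : ∀ i j, B (z i j)) : ∀ p, B (flattenFamily z p) :=
  fun p => h (sigmaFin.symm p).1 (sigmaFin.symm p).2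

/-- A (non-symmetric) operad in the category of sets. The equations are heterogeneous only because
the arities of the two sides are equal, but not definitionally so. -/
structure SetOperad : Type (u + 1) where
  /-- the set of `n`-ary operations -/
  carrier : ℕ → Type u
  /-- the operad unit -/
  one : carrier 1
  /-- the operadic multiplication `μ (g; f₁, …, fₙ)` -/
  mu : ∀ {n : ℕ} {k : Fin n → ℕ}, carrier n → (∀ i, carrier (k i)) → carrier (∑ i, k i)
  one_mu : ∀ {k : ℕ} (g : carrier k), HEq (mu one (fun _ : Fin 1 => g)) g
  mu_one : ∀ {n : ℕ} (g : carrier n), HEq (mu g (fun _ : Fin n => one)) g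
  assoc : ∀ {n : ℕ} {k : Fin n → ℕ} {l : ∀ i, Fin (k i) → ℕ} (f : carrier n)
    (g : ∀ i, carrier (k i)) (h : ∀ i j, carrier (l i j)),
    HEq (mu (mu f g) (flattenDep h)) (mu f (fun i => mu (g i) (h i)))

/-- The bijection of lexicographic concatenations that sends the `j`-th element of the `i`-th block
to the `τ i j`-th element of the `σ i`-th block. -/
def blockEquiv {n m : ℕ} {k : Fin n → ℕ} {l : Fin m → ℕ} (σ : Fin n ≃ Fin m)
    (τ : ∀ i, Fin (k i) ≃ Fin (l (σ i))) : Fin (∑ i, k i) ≃ Fin (∑ i, l i) :=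
  sigmaFin.symm.trans ((Equiv.sigmaCongr σ τ).trans sigmaFin)

lemma blockEquiv_apply {n m : ℕ} {k : Fin n → ℕ} {l : Fin m → ℕ} (σ : Fin n ≃ Fin m)
    (τ : ∀ i, Fin (k i) ≃ Fin (l (σ i))) (p : Fin (∑ i, k i)) :
    blockEquiv σ τ p = sigmaFin ⟨σ (sigmaFin.symm p).1,
      τ (sigmaFin.symm p).1 (sigmaFin.symm p).2⟩ := rfl

lemma symm_blockEquiv {n m : ℕ} {k : Fin n → ℕ} {l : Fin m → ℕ} (σ : Fin n ≃ Fin m)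
    (τ : ∀ i, Fin (k i) ≃ Fin (l (σ i))) (p : Fin (∑ i, k i)) :
    sigmaFin.symm (blockEquiv σ τ p) = ⟨σ (sigmaFin.symm p).1,
      τ (sigmaFin.symm p).1 (sigmaFin.symm p).2⟩ := by
  rw [blockEquiv_apply, Equiv.symm_apply_apply]

lemma blockEquiv_refl {n : ℕ} {k : Fin n → ℕ} :
    blockEquiv (Equiv.refl (Fin n)) (fun i => Equiv.refl (Fin (k i))) = Equiv.refl _ := by
  refine Equiv.ext fun p => ?_
  exact (blockEquiv_apply _ _ p).trans (Equiv.apply_symm_apply sigmaFin p)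

lemma blockEquiv_trans {n m r : ℕ} {k : Fin n → ℕ} {l : Fin m → ℕ} {q : Fin r → ℕ}
    (σ : Fin n ≃ Fin m) (τ : ∀ i, Fin (k i) ≃ Fin (l (σ i)))
    (σ' : Fin m ≃ Fin r) (τ' : ∀ i, Fin (l i) ≃ Fin (q (σ' i))) :
    blockEquiv (σ.trans σ') (fun i => (τ i).trans (τ' (σ i))) =
      (blockEquiv σ τ).trans (blockEquiv σ' τ') := by
  ext p
  rw [Equiv.trans_apply, blockEquiv_apply σ', symm_blockEquiv]
  rfl

/-- The multiplication of the operad of symmetric groups: with `σ ∈ Σₙ` and `τ i ∈ Σ_{k i}`, the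
permutation that sends the `j`-th element of the `i`-th block (of length `k i`) to the
`τ i j`-th element of the `σ i`-th block, the blocks in the target having lengths
`k (σ⁻¹ 0), k (σ⁻¹ 1), …`. -/
def permMu {n : ℕ} {k : Fin n → ℕ} (σ : Equiv.Perm (Fin n))
    (τ : ∀ i, Equiv.Perm (Fin (k i))) : Equiv.Perm (Fin (∑ i, k i)) :=
  (blockEquiv (l := fun i => k (σ.symm i)) σ
    (fun i => (τ i).trans (finCongr (by simp)))).trans (finCongr (Equiv.sum_comp σ.symm k))

/-- An action operad. In `mu_mul_mu` the family `f` has arities `l`, so that the family `f'`, whose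
`i`-th member is to be multiplied with the `π(g')(i)`-th member of `f`, has arities
`l (π(g')(i))`. -/
structure ActionOperad : Type (u + 1) extends SetOperad.{u} where
  [group : ∀ n, Group (carrier n)]
  /-- the underlying permutation -/
  π : ∀ n, carrier n →* Equiv.Perm (Fin n)
  π_mu : ∀ {n : ℕ} {k : Fin n → ℕ} (g : carrier n) (f : ∀ i, carrier (k i)),
    π _ (mu g f) = permMu (π n g) (fun i => π (k i) (f i))
  mu_mul_mu : ∀ {n : ℕ} (l : Fin n → ℕ) (g g' : carrier n) (f : ∀ i, carrier (l i))
    (f' : ∀ i, carrier (l (π n g' i))),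
    cast (congrArg carrier (Equiv.sum_comp (π n g') l).symm) (mu g f) * mu g' f' =
      mu (g * g') (fun i => f (π n g' i) * f' i)

namespace ActionOperad

attribute [instance] ActionOperad.group

/-- A morphism of action operads: a map of operads that consists of group homomorphisms and
commutes with the maps to the symmetric groups. -/
@[ext]
structure Hom (Λ Λ' : ActionOperad.{u}) : Type u where
  toFun : ∀ n, Λ.carrier n →* Λ'.carrier n
  map_one : toFun 1 Λ.one = Λ'.one
  map_mu : ∀ {n : ℕ} {k : Fin n → ℕ} (g : Λ.carrier n) (f : ∀ i, Λ.carrier (k i)),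
    toFun _ (Λ.mu g f) = Λ'.mu (toFun n g) (fun i => toFun (k i) (f i))
  π_comp : ∀ (n : ℕ) (g : Λ.carrier n), Λ'.π n (toFun n g) = Λ.π n g

/-- The category of action operads. -/
instance : Category.{u} ActionOperad.{u} where
  Hom := Hom
  id Λ :=
    { toFun := fun n => MonoidHom.id _
      map_one := rfl
      map_mu := fun _ _ => rfl
      π_comp := fun _ _ => rfl }
  comp F G :=
    { toFun := fun n => (G.toFun n).comp (F.toFun n)
      map_one := by simp [F.map_one, G.map_one]
      map_mu := fun g f => by simp [F.map_mu, G.map_mu]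
      π_comp := fun n g => by simp [F.π_comp, G.π_comp] }

end ActionOperad

/-! ## The monad `EΣ` on categories -/

/-- Objects of the category `EΣ(X) = ∐ₙ EΣₙ ×_{Σₙ} Xⁿ`: every object is uniquely of the form
`[e; x₁, …, xₙ]`, so an object is a finite list of objects of `X`. -/
@[ext]
structure ESigma (X : Type u) : Type u where
  len : ℕ
  obj : Fin len → X

namespace ESigma

variable {X Y Z : Type u} [Category.{u} X] [Category.{u} Y] [Category.{u} Z]

/-- Morphisms `[e; x₁, …, xₙ] ⟶ [e; y₁, …, yₘ]` of `EΣ(X)`: a bijection `σ` of the indices (so there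
are none unless `n = m`) and morphisms `xᵢ ⟶ y_{σ(i)}`. -/
structure Hom (x y : ESigma X) : Type u where
  perm : Fin x.len ≃ Fin y.len
  app : ∀ i, x.obj i ⟶ y.obj (perm i)

instance : Category.{u} (ESigma X) where
  Hom := Hom
  id x := ⟨Equiv.refl _, fun i => 𝟙 (x.obj i)⟩
  comp f g := ⟨f.perm.trans g.perm, fun i => f.app i ≫ g.app (f.perm i)⟩
  id_comp f := by
    cases f; simp; rfl
  comp_id f := by
    cases f; simp; rfl
  assoc f g h := by
    simp; rfl

@[simp] lemma id_perm (x : ESigma X) : Hom.perm (𝟙 x) = Equiv.refl _ := rfl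
@[simp] lemma id_app (x : ESigma X) (i) : Hom.app (𝟙 x) i = 𝟙 (x.obj i) := rfl
@[simp] lemma comp_perm {x y z : ESigma X} (f : x ⟶ y) (g : y ⟶ z) :
    Hom.perm (f ≫ g) = (Hom.perm f).trans (Hom.perm g) := rfl
@[simp] lemma comp_app {x y z : ESigma X} (f : x ⟶ y) (g : y ⟶ z) (i) :
    Hom.app (f ≫ g) i = Hom.app f i ≫ Hom.app g (Hom.perm f i) := rfl

lemma hom_ext {x y : ESigma X} {f g : x ⟶ y} (h : ∀ i, Hom.perm f i = Hom.perm g i)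
    (h' : ∀ i, Hom.app f i ≫ eqToHom (congrArg y.obj (h i)) = Hom.app g i) : f = g := by
  obtain ⟨σ, a⟩ := f
  obtain ⟨τ, b⟩ := g
  obtain rfl : σ = τ := Equiv.ext h
  congr 1
  funext i
  simpa using h' i

/-- The action of `EΣ` on functors. -/
def map (F : X ⥤ Y) : ESigma X ⥤ ESigma Y where
  obj x := ⟨x.len, fun i => F.obj (x.obj i)⟩
  map {x y} f := ⟨Hom.perm (x := x) (y := y) f, fun i => F.map (Hom.app (x := x) (y := y) f i)⟩
  map_id x := hom_ext (fun _ => rfl) (fun i => by simp)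
  map_comp f g := hom_ext (fun _ => rfl) (fun i => by simp)

/-- The unit of the monad `EΣ`: lists of length one. -/
def unit (X : Type u) [Category.{u} X] : X ⥤ ESigma X where
  obj x := ⟨1, fun _ => x⟩
  map f := ⟨Equiv.refl _, fun _ => f⟩
  map_id _ := rfl
  map_comp _ _ := hom_ext (fun _ => rfl) (fun i => by simp)

lemma app_congr {x y : ESigma X} (f : x ⟶ y) {i j : Fin x.len} (h : i = j) :
    Hom.app f i ≫ eqToHom (by rw [h]) = eqToHom (by rw [h]) ≫ Hom.app f j := by
  subst h; simp

lemma app_app_congr {x y : ESigma (ESigma X)} (f : x ⟶ y) {p q : Σ i, Fin (x.obj i).len}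
    (h : p = q) :
    Hom.app (Hom.app f p.1) p.2 ≫ eqToHom (by rw [h]) =
      eqToHom (by rw [h]) ≫ Hom.app (Hom.app f q.1) q.2 := by
  subst h; simp

lemma comp_eqToHom_aux {A B B' C C' D E : X} (a : A ⟶ B) (b : B ⟶ C) (b' : B' ⟶ C')
    (hB : B = B') (hC : C = C') (hb : b ≫ eqToHom hC = eqToHom hB ≫ b')
    (hD : C = D) (hE : D = E) (hE' : C' = E) :
    ((a ≫ b) ≫ eqToHom hD) ≫ eqToHom hE = (a ≫ eqToHom hB) ≫ (b' ≫ eqToHom hE') := by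
  subst hB hC hD hE
  simp at hb
  simp [hb]

/-- Concatenation of lists of lists on morphisms: the `j`-th element of the `i`-th list goes to the
`τᵢ(j)`-th element of the `σ(i)`-th list. -/
def joinMap {x y : ESigma (ESigma X)} (f : x ⟶ y) :
    Hom (⟨∑ i, (x.obj i).len, flattenFamily (fun i => (x.obj i).obj)⟩ : ESigma X)
      ⟨∑ i, (y.obj i).len, flattenFamily (fun i => (y.obj i).obj)⟩ where
  perm := blockEquiv (Hom.perm f) (fun i => Hom.perm (Hom.app f i))
  app := fun p => Hom.app (Hom.app f (sigmaFin.symm p).1) (sigmaFin.symm p).2 ≫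
    eqToHom (by simp only [flattenFamily]; rw [symm_blockEquiv])

/-- The multiplication of the monad `EΣ`: concatenation of lists of lists. -/
def join (X : Type u) [Category.{u} X] : ESigma (ESigma X) ⥤ ESigma X where
  obj x := ⟨∑ i, (x.obj i).len, flattenFamily (fun i => (x.obj i).obj)⟩
  map f := joinMap f
  map_id x := by
    refine hom_ext (fun i => DFunLike.congr_fun blockEquiv_refl i) (fun i => ?_)
    exact (Category.assoc _ _ _).trans ((congrArg _ (eqToHom_trans _ _)).trans
      ((Category.id_comp _).trans (eqToHom_refl _ _)))
  map_comp {x y z} f g :=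
    hom_ext (fun i => DFunLike.congr_fun (blockEquiv_trans (k := fun i => (x.obj i).len)
      (l := fun i => (y.obj i).len) (q := fun i => (z.obj i).len) (Hom.perm f)
      (fun i => Hom.perm (Hom.app f i)) (Hom.perm g) (fun i => Hom.perm (Hom.app g i))) i)
      (fun i => by
        have h := (symm_blockEquiv (l := fun i => (y.obj i).len) (Hom.perm f) (fun i => Hom.perm (Hom.app f i)) i).symm
        have h2 := app_app_congr g h
        exact comp_eqToHom_aux
          (Hom.app (Hom.app f (sigmaFin.symm i).1) (sigmaFin.symm i).2)
          (Hom.app (Hom.app g (Hom.perm f (sigmaFin.symm i).1))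
            (Hom.perm (Hom.app f (sigmaFin.symm i).1) (sigmaFin.symm i).2))
          (Hom.app (Hom.app g (sigmaFin.symm (joinMap f|>.perm i)).1)
            (sigmaFin.symm (joinMap f|>.perm i)).2) _ _ h2 _ _ _)

lemma map_id' (X : Type u) [Category.{u} X] : map (𝟭 X) = 𝟭 (ESigma X) := rfl

lemma map_comp' (F : X ⥤ Y) (G : Y ⥤ Z) : map (F ⋙ G) = map F ⋙ map G := rfl

lemma unit_naturality (F : X ⥤ Y) : unit X ⋙ map F = F ⋙ unit Y := rfl

lemma join_naturality (F : X ⥤ Y) : join X ⋙ map F = map (map F) ⋙ join Y := by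
  refine CategoryTheory.Functor.hext (fun _ => rfl) (fun x y f => heq_of_eq ?_)
  refine hom_ext (fun _ => rfl) (fun i => ?_)
  exact (Category.comp_id _).trans
    ((F.map_comp _ _).trans (congrArg _ (eqToHom_map F _)))

end ESigma

/-! ## Generalized operads for the monad `EΣ` -/

/-- The pullback in the category of categories of two functors with a common target. -/
@[ext]
structure StrictPullback {A B C : Type u} [Category.{u} A] [Category.{u} B] [Category.{u} C]
    (F : A ⥤ C) (G : B ⥤ C) : Type u where
  fst : A
  snd : B
  eq : F.obj fst = G.obj snd

namespace StrictPullback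

variable {A B C D : Type u} [Category.{u} A] [Category.{u} B] [Category.{u} C] [Category.{u} D]

/-- Morphisms of the pullback: pairs of morphisms with the same image, where the sources and the
targets of the images are identified along the equations that are part of the objects. -/
@[ext]
structure Hom {F : A ⥤ C} {G : B ⥤ C} (x y : StrictPullback F G) : Type u where
  fst : x.fst ⟶ y.fst
  snd : x.snd ⟶ y.snd
  eq : F.map fst ≫ eqToHom y.eq = eqToHom x.eq ≫ G.map snd

instance (F : A ⥤ C) (G : B ⥤ C) : Category.{u} (StrictPullback F G) where
  Hom := Hom
  id x := ⟨𝟙 _, 𝟙 _, by simp⟩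
  comp f g := ⟨f.fst ≫ g.fst, f.snd ≫ g.snd, by
    rw [F.map_comp, G.map_comp, Category.assoc, g.eq, ← Category.assoc, f.eq, Category.assoc]⟩

variable {F : A ⥤ C} {G : B ⥤ C}

/-- The first projection. -/
def fstFunctor (F : A ⥤ C) (G : B ⥤ C) : StrictPullback F G ⥤ A where
  obj x := x.fst
  map f := Hom.fst f

/-- The second projection. -/
def sndFunctor (F : A ⥤ C) (G : B ⥤ C) : StrictPullback F G ⥤ B where
  obj x := x.snd
  map f := Hom.snd f

lemma condition (F : A ⥤ C) (G : B ⥤ C) : fstFunctor F G ⋙ F = sndFunctor F G ⋙ G :=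
  CategoryTheory.Functor.ext (fun x => x.eq) (fun x y f => by
    have h := Hom.eq f
    rw [← Category.assoc]
    exact (IsIso.eq_comp_inv (eqToHom y.eq)).2 h |>.trans (by rw [inv_eqToHom]; rfl))

/-- The functor into the pullback that is induced by a commutative square. -/
def lift (P : D ⥤ A) (Q : D ⥤ B) (h : P ⋙ F = Q ⋙ G) : D ⥤ StrictPullback F G where
  obj d := ⟨P.obj d, Q.obj d, Functor.congr_obj h d⟩
  map {d e} f := ⟨P.map f, Q.map f, by
    have := Functor.congr_hom h f
    simp only [Functor.comp_map] at this
    simp [this]⟩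

end StrictPullback

/-- The terminal category. -/
abbrev OneCat : Type u := Discrete PUnit.{u + 1}

/-- The category `BΣ = EΣ(1)`, with objects the natural numbers (as the lengths of lists of objects
of the terminal category) and morphisms the permutations. -/
abbrev BSigma : Type u := ESigma OneCat.{u}

/-- The functor `EΣ(X) ⥤ EΣ(1)` induced by `X ⥤ 1`. -/
abbrev ESigma.toBSigma (X : Type u) [Category.{u} X] : ESigma X ⥤ BSigma.{u} :=
  ESigma.map (Functor.star X)

section CompositionProduct

variable {X Y Z X' Y' : Type u} [Category.{u} X] [Category.{u} Y] [Category.{u} Z]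
  [Category.{u} X'] [Category.{u} Y']

/-- The composition product `X ∘ Y` of a collection `p : X ⥤ EΣ(1)` with `Y`: the pullback of `p`
along `EΣ(Y) ⥤ EΣ(1)`. Its objects are the tuples `(x; y₁, …, yₙ)` with `p x = n`. -/
abbrev CompProd (p : X ⥤ BSigma.{u}) (Y : Type u) [Category.{u} Y] : Type u :=
  StrictPullback p (ESigma.toBSigma Y)

namespace CompProd

/-- The composition product of collections as a collection:
`X ∘ Y ⥤ EΣ(Y) ⥤ EΣ(EΣ(1)) ⥤ EΣ(1)`. -/
abbrev proj (p : X ⥤ BSigma.{u}) (q : Y ⥤ BSigma.{u}) : CompProd p Y ⥤ BSigma.{u} :=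
  StrictPullback.sndFunctor _ _ ⋙ ESigma.map q ⋙ ESigma.join OneCat

/-- The functor `F ∘ G : X ∘ Y ⥤ X' ∘ Y'` for a functor `F` over `EΣ(1)` and a functor `G`. -/
def map {p : X ⥤ BSigma.{u}} {p' : X' ⥤ BSigma.{u}} (F : X ⥤ X') (hF : F ⋙ p' = p)
    (G : Y ⥤ Y') : CompProd p Y ⥤ CompProd p' Y' :=
  StrictPullback.lift (StrictPullback.fstFunctor _ _ ⋙ F)
    (StrictPullback.sndFunctor _ _ ⋙ ESigma.map G) (by
      rw [Functor.assoc, hF]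
      exact StrictPullback.condition _ _)

/-- The associativity isomorphism `X ∘ (Y ∘ Z) ⥤ (X ∘ Y) ∘ Z`,
`(x; (y₁; z₁₁, …), …, (yₙ; zₙ₁, …)) ↦ ((x; y₁, …, yₙ); z₁₁, …)`. -/
def assoc (p : X ⥤ BSigma.{u}) (q : Y ⥤ BSigma.{u}) (Z : Type u) [Category.{u} Z] :
    CompProd p (CompProd q Z) ⥤ CompProd (proj p q) Z :=
  StrictPullback.lift
    (map (𝟭 X) rfl (StrictPullback.fstFunctor q (ESigma.toBSigma Z)))
    (StrictPullback.sndFunctor _ _ ⋙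
      ESigma.map (StrictPullback.sndFunctor q (ESigma.toBSigma Z)) ⋙ ESigma.join Z)
    (by
      have h := congrArg (fun H => StrictPullback.sndFunctor p (ESigma.toBSigma (CompProd q Z)) ⋙
        ESigma.map H ⋙ ESigma.join OneCat) (StrictPullback.condition q (ESigma.toBSigma Z))
      exact h)

/-- The left unit isomorphism `X ⥤ 1 ∘ X`, `x ↦ (∗; x)`. -/
def leftUnit (X : Type u) [Category.{u} X] : X ⥤ CompProd (ESigma.unit OneCat.{u}) X :=
  StrictPullback.lift (Functor.star X) (ESigma.unit X) rfl

/-- The right unit isomorphism `X ⥤ X ∘ 1`, `x ↦ (x; ∗, …, ∗)`. -/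
def rightUnit (p : X ⥤ BSigma.{u}) : X ⥤ CompProd p OneCat.{u} :=
  StrictPullback.lift (𝟭 X) p rfl

end CompProd

end CompositionProduct

/-- A club: a monoid for the composition product of collections, that is, of categories over
`BΣ = EΣ(1)`. -/
structure Club : Type (u + 1) where
  /-- the underlying category -/
  carrier : Type u
  [cat : Category.{u} carrier]
  /-- the functor to `BΣ` -/
  proj : carrier ⥤ BSigma.{u}
  /-- the unit `1 ⥤ K` -/
  one : OneCat.{u} ⥤ carrier
  one_proj : one ⋙ proj = ESigma.unit OneCat
  /-- the multiplication `K ∘ K ⥤ K` -/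
  mul : CompProd proj carrier ⥤ carrier
  mul_proj : mul ⋙ proj = CompProd.proj proj proj
  one_mul : CompProd.leftUnit carrier ⋙ CompProd.map one one_proj (𝟭 carrier) ⋙ mul = 𝟭 carrier
  mul_one : CompProd.rightUnit proj ⋙ CompProd.map (𝟭 carrier) rfl one ⋙ mul = 𝟭 carrier
  mul_assoc : CompProd.assoc proj proj carrier ⋙ CompProd.map mul mul_proj (𝟭 carrier) ⋙ mul =
    CompProd.map (𝟭 carrier) rfl mul ⋙ mul

namespace Club

attribute [instance] Club.cat

/-- A morphism of clubs: a functor over `BΣ` that commutes with the units and the multiplications. -/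
@[ext]
structure Hom (K L : Club.{u}) : Type u where
  functor : K.carrier ⥤ L.carrier
  proj : functor ⋙ L.proj = K.proj
  one : K.one ⋙ functor = L.one
  mul : K.mul ⋙ functor = CompProd.map functor proj functor ⋙ L.mul

/-- The category of clubs. -/
instance : Category.{u} Club.{u} where
  Hom := Hom
  id K := ⟨𝟭 _, rfl, rfl, rfl⟩
  comp {K L M} F G :=
    { functor := F.functor ⋙ G.functor
      proj := by rw [Functor.assoc, G.proj, F.proj]
      one := by rw [← Functor.assoc, F.one, G.one]
      mul := by
        rw [← Functor.assoc, F.mul, Functor.assoc, G.mul]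
        rfl }

end Club

/-! ## The club of an action operad -/

lemma ESigma.perm_eqToHom {X : Type u} [Category.{u} X] {x y : ESigma X} (h : x = y) :
    ESigma.Hom.perm (eqToHom h) = finCongr (congrArg ESigma.len h) := by
  subst h; rfl

/-- The underlying category of the club `K_Λ = BΛ` of an action operad: the objects are the
natural numbers. -/
@[ext]
structure BCat (Λ : ActionOperad.{u}) : Type u where
  arity : ℕ

namespace BCat

variable {Λ : ActionOperad.{u}}

/-- Morphisms of `BΛ`: elements of `Λ(m)` if `m = n`, and none otherwise. -/
@[ext]
structure Hom (m n : BCat Λ) : Type u where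
  eq : m.arity = n.arity
  val : Λ.carrier m.arity

/-- The composition of `BΛ` is the multiplication of the groups `Λ(n)`. -/
instance (Λ : ActionOperad.{u}) : Category.{u} (BCat Λ) where
  Hom := Hom
  id m := ⟨rfl, 1⟩
  comp f g := ⟨f.eq.trans g.eq, cast (congrArg Λ.carrier f.eq.symm) g.val * f.val⟩
  id_comp f := by
    apply Hom.ext
    exact _root_.mul_one _
  comp_id {m n} f := by
    obtain ⟨m⟩ := m
    obtain ⟨n⟩ := n
    obtain ⟨h, f⟩ := f
    obtain rfl : m = n := h
    apply Hom.ext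
    exact _root_.one_mul _
  assoc {m n p q} f g h := by
    obtain ⟨m⟩ := m
    obtain ⟨n⟩ := n
    obtain ⟨p⟩ := p
    obtain ⟨e, f⟩ := f
    obtain ⟨e', g⟩ := g
    obtain rfl : m = n := e
    obtain rfl : m = p := e'
    apply Hom.ext
    exact (_root_.mul_assoc _ _ _).symm

lemma eqToHom_val {m n : BCat Λ} (h : m = n) : Hom.val (eqToHom h) = 1 := by
  subst h; rfl

lemma comp_eqToHom_val {m n p : BCat Λ} (f : m ⟶ n) (h : n = p) :
    Hom.val (f ≫ eqToHom h) = Hom.val f := by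
  subst h; simp

/-- The functor `Bπ : BΛ ⥤ BΣ`. -/
def proj (Λ : ActionOperad.{u}) : BCat Λ ⥤ BSigma.{u} where
  obj m := ⟨m.arity, fun _ => ⟨⟨⟩⟩⟩
  map {m n} f := ⟨(Λ.π m.arity (Hom.val f)).trans (finCongr (Hom.eq (m := m) (n := n) f)),
    fun _ => 𝟙 _⟩
  map_id m := ESigma.hom_ext
    (fun i => by
      change (Λ.π m.arity 1) i = i
      simp)
    (fun _ => rfl)
  map_comp {m n p} f g := by
    obtain ⟨m⟩ := m
    obtain ⟨n⟩ := n
    obtain ⟨p⟩ := p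
    obtain ⟨e, f⟩ := f
    obtain ⟨e', g⟩ := g
    obtain rfl : m = n := e
    obtain rfl : m = p := e'
    refine ESigma.hom_ext (fun i => ?_) (fun _ => rfl)
    change (Λ.π m (g * f)) i = Λ.π m g (Λ.π m f i)
    simp

lemma heq_ext {C : Type u} [Category.{u} C] {F G : C ⥤ BCat Λ}
    (h : ∀ x, (F.obj x).arity = (G.obj x).arity)
    (h' : ∀ {x y : C} (f : x ⟶ y), HEq (Hom.val (F.map f)) (Hom.val (G.map f))) : F = G := by
  refine CategoryTheory.Functor.hext (fun x => BCat.ext (h x)) (fun x y f => ?_)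
  have aux : ∀ {m m' n n' : BCat Λ} (a : m ⟶ n) (b : m' ⟶ n'), m = m' → n = n' →
      HEq (Hom.val a) (Hom.val b) → HEq a b := by
    intro m m' n n' a b h1 h2 h3
    subst h1 h2
    exact heq_of_eq (Hom.ext (eq_of_heq h3))
  exact aux _ _ (BCat.ext (h x)) (BCat.ext (h y)) (h' f)

lemma mu_one_one {n : ℕ} (k : Fin n → ℕ) :
    Λ.mu (1 : Λ.carrier n) (fun i => (1 : Λ.carrier (k i))) = 1 := by
  have h := Λ.mu_mul_mu k 1 1 (fun _ => 1) (fun _ => 1)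
  simp only [_root_.mul_one] at h
  have hσ : Λ.π n 1 = 1 := map_one _
  generalize Λ.π n 1 = σ at h hσ
  subst hσ
  exact mul_eq_right.1 h

/-- The operad unit of an action operad is the unit element of the group `Λ(1)`. -/
lemma one_eq_one : Λ.one = 1 := by
  have h := Λ.mu_mul_mu (n := 1) (fun _ => 1) Λ.one Λ.one (fun _ => Λ.one) (fun _ => 1)
  simp only [_root_.mul_one] at h
  have key : ∀ (N : ℕ) (_ : N = 1) (a b c : Λ.carrier N), HEq a Λ.one →
      HEq b (1 : Λ.carrier 1) → HEq c (Λ.one * Λ.one) → a * b = c → Λ.one = 1 := by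
    rintro N rfl a b c ha hb hc e
    obtain rfl := eq_of_heq ha
    obtain rfl := eq_of_heq hb
    obtain rfl := eq_of_heq hc
    rw [_root_.mul_one] at e
    exact left_eq_mul.1 e
  exact key _ (by simp) _ _ _ ((cast_heq _ _).trans (Λ.one_mu _)) (Λ.one_mu _) (Λ.mu_one _) h

lemma mu_heq {n n' : ℕ} (hn : n = n') {k : Fin n → ℕ} {k' : Fin n' → ℕ} (hk : HEq k k')
    {g : Λ.carrier n} {g' : Λ.carrier n'} (hg : HEq g g')
    {f : ∀ i, Λ.carrier (k i)} {f' : ∀ i, Λ.carrier (k' i)} (hf : HEq f f') :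
    HEq (Λ.mu g f) (Λ.mu g' f') := by
  subst hn
  obtain rfl := eq_of_heq hk
  obtain rfl := eq_of_heq hg
  obtain rfl := eq_of_heq hf
  rfl

lemma len_eq {Y : Type u} [Category.{u} Y] (x : CompProd (proj Λ) Y) : x.fst.arity = x.snd.len :=
  congrArg ESigma.len x.eq

/-- The multiplication of the club on morphisms. -/
def mulMap {x y : CompProd (proj Λ) (BCat Λ)} (f : x ⟶ y) :
    Hom (⟨∑ i, (x.snd.obj i).arity⟩ : BCat Λ) ⟨∑ i, (y.snd.obj i).arity⟩ where
  eq := by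
    dsimp only
    rw [← Equiv.sum_comp (ESigma.Hom.perm (StrictPullback.Hom.snd f))]
    exact Finset.sum_congr rfl (fun i _ => Hom.eq (ESigma.Hom.app (StrictPullback.Hom.snd f) i))
  val := Λ.mu (cast (congrArg Λ.carrier (len_eq x)) (Hom.val (StrictPullback.Hom.fst f)))
    (fun i => Hom.val (ESigma.Hom.app (StrictPullback.Hom.snd f) i))

lemma perm_eq {Y : Type u} [Category.{u} Y] {x y : CompProd (proj Λ) Y} (f : x ⟶ y)
    (i : Fin x.fst.arity) :
    (ESigma.Hom.perm (StrictPullback.Hom.snd f) (Fin.cast (len_eq x) i) : ℕ) =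
      Λ.π _ (Hom.val (StrictPullback.Hom.fst f)) i := by
  have h := congrArg (fun t => (ESigma.Hom.perm t i : ℕ)) (StrictPullback.Hom.eq f)
  simp only [ESigma.comp_perm, ESigma.perm_eqToHom] at h
  exact h.symm

/-- Every morphism of `K ∘ K` is, up to the equations between objects, of the following form. -/
def stdHom {Y : Type u} [Category.{u} Y] {n : ℕ} (g : Λ.carrier n) (k k' : Fin n → Y)
    (t : ∀ i, k i ⟶ k' (Λ.π n g i)) :
    (⟨⟨n⟩, ⟨n, k⟩, rfl⟩ : CompProd (proj Λ) Y) ⟶ ⟨⟨n⟩, ⟨n, k'⟩, rfl⟩ :=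
  ⟨⟨rfl, g⟩, ⟨Λ.π n g, t⟩, rfl⟩

lemma exists_stdObj {Y : Type u} [Category.{u} Y] (x : CompProd (proj Λ) Y) :
    ∃ (n : ℕ) (k : Fin n → Y), x = ⟨⟨n⟩, ⟨n, k⟩, rfl⟩ := by
  obtain ⟨⟨a⟩, ⟨n, k⟩, e⟩ := x
  obtain rfl : a = n := congrArg ESigma.len e
  exact ⟨a, k, rfl⟩

lemma exists_stdHom {Y : Type u} [Category.{u} Y] {n m : ℕ} {k : Fin n → Y} {k' : Fin m → Y}
    (f : (⟨⟨n⟩, ⟨n, k⟩, rfl⟩ : CompProd (proj Λ) Y) ⟶ ⟨⟨m⟩, ⟨m, k'⟩, rfl⟩) :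
    ∃ (h : n = m) (g : Λ.carrier n) (t : ∀ i, k i ⟶ (k' ∘ Fin.cast h) (Λ.π n g i)),
      HEq f (stdHom g k (k' ∘ Fin.cast h) t) := by
  have hp := perm_eq f
  obtain ⟨⟨e, g⟩, ⟨σ, t⟩, h⟩ := f
  obtain rfl : n = m := e
  obtain rfl : σ = Λ.π n g := Equiv.ext (fun i => Fin.ext (hp i))
  exact ⟨rfl, g, t, HEq.rfl⟩

lemma stdHom_induction {Y : Type u} [Category.{u} Y]
    {P : ∀ {x y : CompProd (proj Λ) Y}, (x ⟶ y) → Prop}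
    (h : ∀ {n : ℕ} (g : Λ.carrier n) (k k' : Fin n → Y) (t : ∀ i, k i ⟶ k' (Λ.π n g i)),
      P (stdHom g k k' t))
    {x y : CompProd (proj Λ) Y} (f : x ⟶ y) : P f := by
  obtain ⟨n, k, rfl⟩ := exists_stdObj x
  obtain ⟨m, k', rfl⟩ := exists_stdObj y
  obtain ⟨rfl, g, t, hf⟩ := exists_stdHom f
  obtain rfl := eq_of_heq hf
  exact h _ _ _ _

/-- The multiplication of the club `K_Λ`, `(n; k₁, …, kₙ) ↦ k₁ + ⋯ + kₙ` on objects and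
`(g; f₁, …, fₙ) ↦ μ (g; f₁, …, fₙ)` on morphisms. -/
def mul (Λ : ActionOperad.{u}) : CompProd (proj Λ) (BCat Λ) ⥤ BCat Λ where
  obj x := ⟨∑ i, (x.snd.obj i).arity⟩
  map f := mulMap f
  map_id x := by
    obtain ⟨n, k, rfl⟩ := exists_stdObj x
    apply Hom.ext
    exact mu_one_one _
  map_comp {x y z} f g := by
    obtain ⟨n, k, rfl⟩ := exists_stdObj x
    obtain ⟨m, k', rfl⟩ := exists_stdObj y
    obtain ⟨r, k'', rfl⟩ := exists_stdObj z
    obtain ⟨rfl, g₁, t₁, hf⟩ := exists_stdHom f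
    obtain rfl := eq_of_heq hf
    obtain ⟨rfl, g₂, t₂, hg⟩ := exists_stdHom g
    obtain rfl := eq_of_heq hg
    clear hf hg
    apply Hom.ext
    have hk : ∃ l : Fin n → ℕ, k' = fun i => ⟨l i⟩ := ⟨fun i => (k' i).arity, rfl⟩
    obtain ⟨l, rfl⟩ := hk
    obtain rfl : k = fun i => ⟨l (Λ.π n g₁ i)⟩ := funext fun i => BCat.ext (Hom.eq (t₁ i))
    exact (Λ.mu_mul_mu l g₂ g₁ (fun i => Hom.val (t₂ i)) (fun i => Hom.val (t₁ i))).symm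

lemma blockEquiv_congr {n m : ℕ} {k : Fin n → ℕ} {l l' : Fin m → ℕ} (hl : l = l')
    (σ : Fin n ≃ Fin m) (τ : ∀ i, Fin (k i) ≃ Fin (l (σ i))) :
    (blockEquiv σ τ).trans (finCongr (by rw [hl])) =
      blockEquiv (l := l') σ (fun i => (τ i).trans (finCongr (by rw [hl]))) := by
  subst hl; rfl

lemma permMu_trans {n : ℕ} (l : Fin n → ℕ) (σ : Equiv.Perm (Fin n))
    (τ : ∀ i, Equiv.Perm (Fin (l (σ i)))) :
    (permMu (k := fun i => l (σ i)) σ τ).trans (finCongr (Equiv.sum_comp σ l)) =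
      blockEquiv (l := l) σ τ :=
  blockEquiv_congr (l := fun i => l (σ (σ.symm i))) (l' := l) (by simp) σ
    (fun i => (τ i).trans (finCongr (by simp)))

lemma mul_proj (Λ : ActionOperad.{u}) : mul Λ ⋙ proj Λ = CompProd.proj (proj Λ) (proj Λ) := by
  refine CategoryTheory.Functor.hext (fun _ => rfl) (fun x y f => heq_of_eq ?_)
  obtain ⟨n, k, rfl⟩ := exists_stdObj x
  obtain ⟨m, k', rfl⟩ := exists_stdObj y
  obtain ⟨rfl, g, t, hf⟩ := exists_stdHom f
  obtain rfl := eq_of_heq hf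
  clear hf
  have hk : ∃ l : Fin n → ℕ, k' = fun i => ⟨l i⟩ := ⟨fun i => (k' i).arity, rfl⟩
  obtain ⟨l, rfl⟩ := hk
  obtain rfl : k = fun i => ⟨l (Λ.π n g i)⟩ := funext fun i => BCat.ext (Hom.eq (t i))
  refine ESigma.hom_ext (fun i => ?_) (fun _ => rfl)
  change ((Λ.π _ (Λ.mu g (fun i => Hom.val (t i)))).trans (finCongr _)) i = _
  rw [Λ.π_mu]
  exact DFunLike.congr_fun (permMu_trans l (Λ.π n g) (fun i => Λ.π _ (Hom.val (t i)))) i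

/-- The unit of the club `K_Λ`: the object `1`. -/
def one (Λ : ActionOperad.{u}) : OneCat.{u} ⥤ BCat Λ := Functor.fromPUnit ⟨1⟩

lemma one_proj (Λ : ActionOperad.{u}) : one Λ ⋙ proj Λ = ESigma.unit OneCat :=
  CategoryTheory.Functor.hext (fun _ => rfl) (fun _ _ _ => heq_of_eq
    (ESigma.hom_ext (fun _ => Subsingleton.elim (α := Fin 1) _ _) (fun _ => rfl)))

lemma one_mul (Λ : ActionOperad.{u}) :
    CompProd.leftUnit (BCat Λ) ⋙ CompProd.map (one Λ) (one_proj Λ) (𝟭 (BCat Λ)) ⋙ mul Λ =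
      𝟭 (BCat Λ) :=
  heq_ext (fun x => Fin.sum_univ_one (fun _ : Fin 1 => x.arity)) (fun {x y} f => by
    have h := Λ.one_mu (Hom.val f)
    rw [one_eq_one] at h
    exact h)

lemma mul_one (Λ : ActionOperad.{u}) :
    CompProd.rightUnit (proj Λ) ⋙ CompProd.map (𝟭 (BCat Λ)) rfl (one Λ) ⋙ mul Λ =
      𝟭 (BCat Λ) :=
  heq_ext (fun x => (by simp : ∑ _i : Fin x.arity, 1 = x.arity)) (fun {x y} f => by
    have h := Λ.mu_one (Hom.val f)
    rw [one_eq_one] at h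
    exact h)

lemma sum_flattenFamily {n : ℕ} {k : Fin n → ℕ} (z : ∀ i, Fin (k i) → ℕ) :
    ∑ p, flattenFamily z p = ∑ i, ∑ j, z i j := by
  rw [← Equiv.sum_comp sigmaFin, Fintype.sum_sigma]
  refine Finset.sum_congr rfl fun i _ => Finset.sum_congr rfl fun j _ => ?_
  simp only [flattenFamily]
  rw [Equiv.symm_apply_apply]

lemma mul_assoc (Λ : ActionOperad.{u}) :
    CompProd.assoc (proj Λ) (proj Λ) (BCat Λ) ⋙
        CompProd.map (mul Λ) (mul_proj Λ) (𝟭 (BCat Λ)) ⋙ mul Λ =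
      CompProd.map (𝟭 (BCat Λ)) rfl (mul Λ) ⋙ mul Λ := by
  refine heq_ext (fun x => ?_) (fun {x y} f => ?_)
  · obtain ⟨n, k, rfl⟩ := exists_stdObj x
    choose a l hl using fun i => exists_stdObj (k i)
    obtain rfl : k = _ := funext hl
    exact sum_flattenFamily (fun i j => (l i j).arity)
  · obtain ⟨n, k, rfl⟩ := exists_stdObj x
    obtain ⟨m, k', rfl⟩ := exists_stdObj y
    obtain ⟨rfl, g, t, hf⟩ := exists_stdHom f
    obtain rfl := eq_of_heq hf
    clear hf
    choose a l hl using fun i => exists_stdObj (k i)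
    obtain rfl : k = _ := funext hl
    clear hl
    refine HEq.trans ?_ (Λ.assoc g (fun i => Hom.val (StrictPullback.Hom.fst (t i)))
      (fun i j => Hom.val (ESigma.Hom.app (StrictPullback.Hom.snd (t i)) j)))
    refine mu_heq rfl HEq.rfl HEq.rfl (heq_of_eq (funext fun p => ?_))
    exact comp_eqToHom_val _ _

end BCat

/-- The club `K_Λ` of an action operad `Λ`. -/
def ActionOperad.club (Λ : ActionOperad.{u}) : Club.{u} where
  carrier := BCat Λ
  proj := BCat.proj Λ
  one := BCat.one Λ
  one_proj := BCat.one_proj Λ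
  mul := BCat.mul Λ
  mul_proj := BCat.mul_proj Λ
  one_mul := BCat.one_mul Λ
  mul_one := BCat.mul_one Λ
  mul_assoc := BCat.mul_assoc Λ

/-- The functor `Bf : BΛ ⥤ BΛ'`. -/
def BCat.map {Λ Λ' : ActionOperad.{u}} (F : Λ ⟶ Λ') : BCat Λ ⥤ BCat Λ' where
  obj m := ⟨m.arity⟩
  map {m n} f := ⟨BCat.Hom.eq (m := m) (n := n) f,
    ActionOperad.Hom.toFun F m.arity (BCat.Hom.val (m := m) (n := n) f)⟩
  map_id m := BCat.Hom.ext (map_one (ActionOperad.Hom.toFun F m.arity))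
  map_comp {m n p} f g := by
    obtain ⟨m⟩ := m
    obtain ⟨n⟩ := n
    obtain ⟨p⟩ := p
    obtain ⟨e, f⟩ := f
    obtain ⟨e', g⟩ := g
    obtain rfl : m = n := e
    obtain rfl : m = p := e'
    exact BCat.Hom.ext (map_mul (ActionOperad.Hom.toFun F m) _ _)

/-- The assignment `Λ ↦ K_Λ`, as a functor from the category of action operads to the category of
clubs. -/
def clubFunctor : ActionOperad.{u} ⥤ Club.{u} where
  obj Λ := Λ.club
  map {Λ Λ'} F :=
    { functor := BCat.map F
      proj := CategoryTheory.Functor.hext (fun _ => rfl) (fun x y f => heq_of_eq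
        (ESigma.hom_ext (fun i => by
          exact congrArg (fun σ => (σ.trans (finCongr (BCat.Hom.eq f))) i)
            (ActionOperad.Hom.π_comp F _ (BCat.Hom.val f))) (fun _ => rfl)))
      one := BCat.heq_ext (fun _ => rfl) (fun f => heq_of_eq
        (map_one (ActionOperad.Hom.toFun F 1)))
      mul := BCat.heq_ext (fun _ => rfl) (fun {x y} f => heq_of_eq (by
        obtain ⟨n, k, rfl⟩ := BCat.exists_stdObj x
        exact ActionOperad.Hom.map_mu F _ _)) }
  map_id Λ := rfl
  map_comp F G := rfl

/-! A morphism of BΣ exists only between lists of equal length. Hence, if K → BΣ is injective on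
objects, every morphism of K is an endomorphism; if it is bijective, K amounts to the family of
monoids `Op hK n` of endomorphisms of the object over n, and these are groups when K is a groupoid.
The club structure then becomes an action operad, axiom by axiom. The functor to BΣ gives π, and the
multiplication on a morphism (g; f₁, …, fₙ) gives μ. Its compatibility with BΣ is the formula for π
of μ (`perm_opMu`), the monoid laws are the operad laws (`one_opMu`, `opMu_one`, `opMu_assoc`), and
its functoriality is the interchange law (`opMu_mul_opMu`). Including the endomorphism groups into K
gives `isoClub`.

For full faithfulness, a morphism of clubs lies over BΣ and therefore preserves arities, so it is a
family of maps Λ(n) → Λ'(n) (`opMap`). Functoriality makes them homomorphisms, and compatibility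
with the multiplications makes them preserve μ.

The product of (n; k₁, …, kₙ) agrees with the object over k₁ + ⋯ + kₙ only propositionally, so
morphisms are compared by `HEq`. The central tool is `opMu_heq_map`: it recognises a value of the
club multiplication as an `opMu` from its components alone. -/

namespace CategoryTheory

/-! ### Heterogeneous equality of morphisms, and the category BΣ. -/

variable {C D : Type u} [Category.{u} C] [Category.{u} D]

lemma heq_comp_of_heq {x y z x' y' z' : C} {f : x ⟶ y} {g : y ⟶ z} {f' : x' ⟶ y'} {g' : y' ⟶ z'}
    (hx : x = x') (hy : y = y') (hz : z = z') (hf : HEq f f') (hg : HEq g g') :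
    HEq (f ≫ g) (f' ≫ g') := by
  subst hx hy hz
  obtain rfl := eq_of_heq hf
  obtain rfl := eq_of_heq hg
  rfl

lemma Functor.map_heq_of_heq (F : C ⥤ D) {x y x' y' : C} {f : x ⟶ y} {f' : x' ⟶ y'}
    (hx : x = x') (hy : y = y') (hf : HEq f f') : HEq (F.map f) (F.map f') := by
  subst hx hy
  obtain rfl := eq_of_heq hf
  rfl

lemma Functor.map_heq_of_eq {F G : C ⥤ D} (h : F = G) {x y : C} (f : x ⟶ y) :
    HEq (F.map f) (G.map f) := by
  subst h; rfl

end CategoryTheory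

lemma ESigma.len_eq_of_hom {X : Type u} [Category.{u} X] {x y : ESigma X} (f : x ⟶ y) :
    x.len = y.len :=
  Fin.equiv_iff_eq.1 ⟨ESigma.Hom.perm f⟩

/-- The object `n` of `BΣ`. -/
abbrev BSigma.of (n : ℕ) : BSigma.{u} := ⟨n, fun _ => ⟨⟨⟩⟩⟩

lemma BSigma.obj_ext {x y : BSigma.{u}} (h : x.len = y.len) : x = y := by
  obtain ⟨n, x⟩ := x
  obtain ⟨m, y⟩ := y
  obtain rfl : n = m := h
  exact congrArg _ (Subsingleton.elim x y)

lemma BSigma.hom_ext {x y : BSigma.{u}} {f g : x ⟶ y}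
    (h : ESigma.Hom.perm f = ESigma.Hom.perm g) : f = g :=
  ESigma.hom_ext (fun i => DFunLike.congr_fun h i) (fun _ => Subsingleton.elim _ _)

/-- The underlying permutation of an endomorphism in `BΣ`. -/
def BSigma.permHom (n : ℕ) : End (BSigma.of.{u} n) →* Equiv.Perm (Fin n) where
  toFun f := ESigma.Hom.perm (X := OneCat.{u}) (x := BSigma.of n) (y := BSigma.of n) f
  map_one' := rfl
  map_mul' _ _ := rfl

/-! ### Clubs over BΣ with one object in each arity. -/

namespace Club

variable (K : Club.{u})

/-- The natural number under an object of a club. -/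
abbrev arity (x : K.carrier) : ℕ := (K.proj.obj x).len

lemma arity_mul (x : CompProd K.proj K.carrier) :
    K.arity (K.mul.obj x) = ∑ i, K.arity (x.snd.obj i) :=
  congrArg ESigma.len (Functor.congr_obj K.mul_proj x)

variable {K}

lemma obj_ext (hK : Function.Injective K.proj.obj) {x y : K.carrier} (h : K.arity x = K.arity y) : x = y :=
  hK (BSigma.obj_ext h)

lemma eq_of_hom (hK : Function.Injective K.proj.obj) {x y : K.carrier} (f : x ⟶ y) : x = y :=
  obj_ext hK (ESigma.len_eq_of_hom (K.proj.map f))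

end Club

namespace Club

variable {K : Club.{u}} (hK : Function.Bijective K.proj.obj)

/-- The object over the natural number `n`. -/
noncomputable def ofArity (n : ℕ) : K.carrier :=
  (Equiv.ofBijective _ hK).symm (BSigma.of n)

lemma proj_ofArity (n : ℕ) : K.proj.obj (ofArity hK n) = BSigma.of n :=
  (Equiv.ofBijective _ hK).apply_symm_apply _

lemma arity_ofArity (n : ℕ) : K.arity (ofArity hK n) = n :=
  congrArg ESigma.len (proj_ofArity hK n)

lemma eq_ofArity {x : K.carrier} {n : ℕ} (h : K.arity x = n) : x = ofArity hK n :=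
  obj_ext hK.1 (h.trans (arity_ofArity hK n).symm)

/-- The endomorphisms of the object over `n`, which become the `n`-ary operations of an operad. -/
abbrev Op (n : ℕ) : Type u := End (ofArity hK n)

/-- The underlying permutation of an operation. -/
noncomputable def perm (n : ℕ) : Op hK n →* Equiv.Perm (Fin n) :=
  (BSigma.permHom n).comp
    { toFun := fun g => End.of
        (eqToHom (proj_ofArity hK n).symm ≫ K.proj.map g ≫ eqToHom (proj_ofArity hK n))
      map_one' := by
        simp
      map_mul' := fun f g => by simp [End.mul_def] }

/-- Lets `perm` be computed from any representative of `K.proj.map g` in BΣ whose source and target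
have length n only propositionally; `finCongr` corrects the index sets. -/
lemma perm_eq_of_heq {n : ℕ} (g : Op hK n) {x y : BSigma.{u}} (f : x ⟶ y)
    (hx : x.len = n) (h : HEq f (K.proj.map g)) :
    (finCongr hx.symm).trans ((ESigma.Hom.perm f).trans
      (finCongr ((ESigma.len_eq_of_hom f).symm.trans hx))) = perm hK n g := by
  obtain rfl : x = BSigma.of n := BSigma.obj_ext hx
  obtain rfl : y = BSigma.of n := BSigma.obj_ext (ESigma.len_eq_of_hom f).symm
  have : f = eqToHom (proj_ofArity hK n).symm ≫ K.proj.map g ≫ eqToHom (proj_ofArity hK n) := by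
    rw [conj_eqToHom_iff_heq']
    exact h
  rw [this]
  rfl

/-! ### Normal forms in K ∘ Y and the operadic multiplication. -/

section

variable {Y : Type u} [Category.{u} Y]

/-- The object `(n; k₀, …, kₙ₋₁)` of `K ∘ Y`. -/
noncomputable abbrev stdObj {n : ℕ} (k : Fin n → Y) : CompProd K.proj Y :=
  ⟨ofArity hK n, ⟨n, k⟩, proj_ofArity hK n⟩

/-- The morphism `(g; t₀, …, tₙ₋₁)` of `K ∘ Y`. -/
noncomputable def stdHom {n : ℕ} (g : Op hK n) (k l : Fin n → Y)
    (t : ∀ i, k i ⟶ l (perm hK n g i)) : stdObj hK k ⟶ stdObj hK l :=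
  ⟨g, ⟨perm hK n g, t⟩, by
    rw [← IsIso.inv_comp_eq, inv_eqToHom]
    exact BSigma.hom_ext rfl⟩

lemma exists_stdObj (x : CompProd K.proj Y) :
    ∃ (n : ℕ) (k : Fin n → Y), x = stdObj hK k := by
  obtain ⟨a, ⟨n, k⟩, e⟩ := x
  obtain rfl : a = ofArity hK n := eq_ofArity hK (congrArg ESigma.len e)
  exact ⟨n, k, rfl⟩

/-- The pullback equation forces σ to be the permutation underlying g, so g and the entries t
determine the morphism. -/
lemma exists_stdHom {n m : ℕ} {k : Fin n → Y} {l : Fin m → Y}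
    (f : stdObj hK k ⟶ stdObj hK l) :
    ∃ (h : m = n) (g : Op hK n) (t : ∀ i, k i ⟶ (l ∘ Fin.cast h.symm) (perm hK n g i)),
      HEq f (stdHom hK g k (l ∘ Fin.cast h.symm) t) := by
  obtain ⟨g, ⟨σ, t⟩, h⟩ := f
  obtain rfl : m = n := (Fin.equiv_iff_eq.1 ⟨σ⟩).symm
  obtain rfl : σ = perm hK m g := by
    dsimp only at h g t
    have h' := (IsIso.inv_comp_eq _).2 h
    rw [inv_eqToHom] at h'
    exact congrArg ESigma.Hom.perm h'.symm
  exact ⟨rfl, g, t, HEq.rfl⟩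

end

lemma mul_stdObj {n : ℕ} (k : Fin n → ℕ) {l : Fin n → K.carrier}
    (h : ∀ i, K.arity (l i) = k i) :
    K.mul.obj (stdObj hK l) = ofArity hK (∑ i, k i) :=
  eq_ofArity hK ((K.arity_mul _).trans (Finset.sum_congr rfl fun i _ => h i))

/-- The operadic multiplication. -/
noncomputable def opMu {n : ℕ} {k : Fin n → ℕ} (g : Op hK n) (f : ∀ i, Op hK (k i)) :
    Op hK (∑ i, k i) :=
  eqToHom (mul_stdObj hK k fun i => arity_ofArity hK (k i)).symm ≫
    K.mul.map (stdHom hK g (fun i => ofArity hK (k i))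
      -- Entry i is sent to position `perm hK n g i`, so the target blocks are the source blocks in
      -- permuted order; their total length is unchanged.
      (fun i => ofArity hK (k ((perm hK n g).symm i)))
      (fun i => f i ≫ eqToHom (by simp only [Equiv.symm_apply_apply]))) ≫
    eqToHom (eq_ofArity hK ((K.arity_mul _).trans
      ((Finset.sum_congr rfl fun i _ => arity_ofArity hK (k ((perm hK n g).symm i))).trans
        (Equiv.sum_comp (perm hK n g).symm k))))

/-- The target list b can be arbitrary: each t i is an endomorphism up to equality of objects and
the permutation is surjective, so b is forced to be the list used in `opMu`. -/
lemma opMu_heq_map_stdHom {n : ℕ} {k : Fin n → ℕ} (g : Op hK n) (f : ∀ i, Op hK (k i))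
    {a b : Fin n → K.carrier} (t : ∀ i, a i ⟶ b (perm hK n g i))
    (ha : ∀ i, a i = ofArity hK (k i)) (h : ∀ i, HEq (f i) (t i)) :
    HEq (opMu hK g f) (K.mul.map (stdHom hK g a b t)) := by
  obtain rfl : a = fun i => ofArity hK (k i) := funext ha
  obtain rfl : b = fun i => ofArity hK (k ((perm hK n g).symm i)) := by
    funext i
    obtain ⟨i, rfl⟩ := (perm hK n g).surjective i
    rw [Equiv.symm_apply_apply, ← eq_of_hom hK.1 (t i)]
  obtain rfl : (fun i => f i ≫ eqToHom (by simp only [Equiv.symm_apply_apply])) = t :=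
    funext fun i => eq_of_heq (((comp_eqToHom_heq _ _)).trans (h i))
  rw [← conj_eqToHom_iff_heq']
  rfl

/-- Entries are matched by the numerical values of their indices, because `x.snd.len` is not
definitionally n. The target y needs no condition, since φ determines it. -/
lemma opMu_heq_map {n : ℕ} {k : Fin n → ℕ} (g : Op hK n) (f : ∀ i, Op hK (k i))
    {x y : CompProd K.proj K.carrier} (φ : x ⟶ y) (hx : x.fst = ofArity hK n)
    (hk : ∀ (i : Fin n) (j : Fin x.snd.len), (i : ℕ) = (j : ℕ) → x.snd.obj j = ofArity hK (k i))
    (hg : HEq g (StrictPullback.Hom.fst φ))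
    (hf : ∀ (i : Fin n) (j : Fin x.snd.len), (i : ℕ) = (j : ℕ) →
      HEq (f i) (ESigma.Hom.app (StrictPullback.Hom.snd φ) j)) :
    HEq (opMu hK g f) (K.mul.map φ) := by
  obtain ⟨n', a, rfl⟩ := exists_stdObj hK x
  obtain ⟨m', b, rfl⟩ := exists_stdObj hK y
  obtain ⟨rfl, g', t, h⟩ := exists_stdHom hK φ
  obtain rfl := eq_of_heq h
  obtain rfl : m' = n :=
    (arity_ofArity hK m').symm.trans ((congrArg K.arity hx).trans (arity_ofArity hK n))
  obtain rfl : g = g' := eq_of_heq hg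
  exact opMu_heq_map_stdHom hK g f t (fun i => hk i i rfl) (fun i => hf i i rfl)

end Club

/-! ### The axioms of an action operad for `Op`. -/

lemma permMu_eq_blockEquiv {n : ℕ} {k a b : Fin n → ℕ} (σ : Equiv.Perm (Fin n))
    (τ : ∀ i, Equiv.Perm (Fin (k i))) (τ' : ∀ i, Fin (a i) ≃ Fin (b (σ i)))
    (ha : ∀ i, a i = k i) (hb : ∀ i, b (σ i) = k i)
    (hτ : ∀ i, (finCongr (ha i).symm).trans ((τ' i).trans (finCongr (hb i))) = τ i)
    (h₁ : ∑ i, k i = ∑ i, a i) (h₂ : ∑ i, b i = ∑ i, k i) :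
    (finCongr h₁).trans ((blockEquiv σ τ').trans (finCongr h₂)) = permMu σ τ := by
  obtain rfl : a = k := funext ha
  obtain rfl : b = fun i => a (σ.symm i) := by
    funext i
    obtain ⟨i, rfl⟩ := σ.surjective i
    rw [hb, Equiv.symm_apply_apply]
  obtain rfl := funext hτ
  rfl

namespace Club

variable {K : Club.{u}} (hK : Function.Bijective K.proj.obj)

/-- The entries of a morphism in K ∘ Y have targets of the form b (σ i); substituting this form for
a family removes transports along σ⁻¹σ = 1. -/
lemma exists_comp_eq {C : Type*} {n : ℕ} (σ : Equiv.Perm (Fin n)) (c : Fin n → C) :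
    ∃ b : Fin n → C, c = fun i => b (σ i) :=
  ⟨fun i => c (σ.symm i), funext fun i => by simp only [Equiv.symm_apply_apply]⟩

lemma one_obj (x : OneCat.{u}) : K.one.obj x = ofArity hK 1 :=
  eq_ofArity hK (congrArg ESigma.len (Functor.congr_obj K.one_proj x))

lemma id_heq_one_map {x y : OneCat.{u}} (f : x ⟶ y) : HEq (1 : Op hK 1) (K.one.map f) := by
  obtain rfl : x = y := Subsingleton.elim _ _
  obtain rfl : f = 𝟙 x := Subsingleton.elim _ _
  rw [K.one.map_id, one_obj hK x]
  rfl

/-- This is the left unit law of K evaluated at g: the functor into K ∘ K that occurs there sends g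
to a morphism with components 1 and g. -/
lemma one_opMu {k : ℕ} (g : Op hK k) :
    HEq (opMu hK (1 : Op hK 1) (fun _ : Fin 1 => g)) g :=
  (opMu_heq_map hK _ _ ((CompProd.leftUnit K.carrier ⋙
    CompProd.map K.one K.one_proj (𝟭 K.carrier)).map g) (one_obj hK _) (fun _ _ _ => rfl)
    (id_heq_one_map hK _) (fun _ _ _ => HEq.rfl)).trans (Functor.map_heq_of_eq K.one_mul g)

lemma opMu_one {n : ℕ} (g : Op hK n) :
    HEq (opMu hK g (fun _ : Fin n => (1 : Op hK 1))) g :=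
  (opMu_heq_map hK _ _ ((CompProd.rightUnit K.proj ⋙
    CompProd.map (𝟭 K.carrier) rfl K.one).map g) rfl (fun _ _ _ => one_obj hK _)
    HEq.rfl (fun _ _ _ => id_heq_one_map hK _)).trans (Functor.map_heq_of_eq K.mul_one g)

lemma exists_stdHom_heq {n : ℕ} {k : Fin n → ℕ} (g : Op hK n) (f : ∀ i, Op hK (k i)) :
    ∃ (b : Fin n → K.carrier) (t : ∀ i, ofArity hK (k i) ⟶ b (perm hK n g i)),
      (∀ i, b (perm hK n g i) = ofArity hK (k i)) ∧ ∀ i, HEq (f i) (t i) := by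
  obtain ⟨b, hb⟩ := exists_comp_eq (perm hK n g) fun i => ofArity hK (k i)
  exact ⟨b, fun i => f i ≫ eqToHom (congrFun hb i), fun i => (congrFun hb i).symm,
    fun i => (comp_eqToHom_heq _ _).symm⟩

/-- By `mul_proj`, the permutation under a product is the one given by concatenation in EΣ, which is
a `blockEquiv` of the permutations under the factors. -/
lemma perm_opMu {n : ℕ} {k : Fin n → ℕ} (g : Op hK n) (f : ∀ i, Op hK (k i)) :
    perm hK _ (opMu hK g f) = permMu (perm hK n g) (fun i => perm hK (k i) (f i)) := by
  obtain ⟨b, t, hb, ht⟩ := exists_stdHom_heq hK g f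
  let φ := stdHom hK g (fun i => ofArity hK (k i)) b t
  have h : HEq ((CompProd.proj K.proj K.proj).map φ) (K.proj.map (opMu hK g f)) := by
    have hx := mul_stdObj hK k fun i => arity_ofArity hK (k i)
    have hy := (eq_of_hom hK.1 (K.mul.map φ)).symm.trans hx
    exact (Functor.map_heq_of_eq K.mul_proj φ).symm.trans
      (K.proj.map_heq_of_heq hx hy (opMu_heq_map_stdHom hK g f t (fun _ => rfl) ht).symm)
  have hl : ∑ i, K.arity (ofArity hK (k i)) = ∑ i, k i :=
    Finset.sum_congr rfl fun i _ => arity_ofArity hK (k i)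
  have h₁ := perm_eq_of_heq hK _ _ hl h
  have h₂ : ∀ i, _ := fun i => perm_eq_of_heq hK (f i) (K.proj.map (t i)) (arity_ofArity hK (k i))
    (K.proj.map_heq_of_heq rfl (hb i) (ht i).symm)
  refine h₁.symm.trans ?_
  have hb' : ∀ i, K.arity (b (perm hK n g i)) = k i := fun i =>
    (congrArg K.arity (hb i)).trans (arity_ofArity hK (k i))
  -- The blocks have lengths `K.arity (ofArity hK (k i))` rather than k i; this lemma absorbs the
  -- reindexing.
  have h₃ := permMu_eq_blockEquiv (perm hK n g) (fun i => perm hK (k i) (f i))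
    (b := fun i => K.arity (b i))
    (fun i => ESigma.Hom.perm (K.proj.map (t i))) (fun i => arity_ofArity hK (k i)) hb' h₂
    hl.symm ((ESigma.len_eq_of_hom ((CompProd.proj K.proj K.proj).map φ)).symm.trans hl)
  exact h₃

/-- Both bracketings are values of the two sides of `K.mul_assoc` at a single morphism φ of K ∘ (K ∘
K). -/
lemma opMu_assoc {n : ℕ} {k : Fin n → ℕ} {l : ∀ i, Fin (k i) → ℕ} (f : Op hK n)
    (g : ∀ i, Op hK (k i)) (h : ∀ i j, Op hK (l i j)) :
    HEq (opMu hK (opMu hK f g) (flattenDep (B := fun n => Op hK n) h))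
      (opMu hK f (fun i => opMu hK (g i) (h i))) := by
  choose b t hb ht using fun i => exists_stdHom_heq hK (g i) (h i)
  -- The existential makes the family of targets c a variable, so that it can be replaced by a
  -- family of the form d (σ i).
  have key : ∃ (c : Fin n → CompProd K.proj K.carrier)
      (s : ∀ i, stdObj hK (fun j => ofArity hK (l i j)) ⟶ c i),
      ∀ i, HEq (g i) (StrictPullback.Hom.fst (s i)) ∧
        ∀ j, HEq (h i j) (ESigma.Hom.app (StrictPullback.Hom.snd (s i)) j) :=
    ⟨fun i => stdObj hK (b i), fun i => stdHom hK (g i) _ _ (t i), fun i => ⟨HEq.rfl, ht i⟩⟩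
  obtain ⟨c, s, hs⟩ := key
  obtain ⟨d, rfl⟩ := exists_comp_eq (perm hK n f) c
  let φ := stdHom hK f _ d s
  have e := Functor.map_heq_of_eq K.mul_assoc φ
  refine HEq.trans ?_ (e.trans ?_)
  · refine opMu_heq_map hK _ _ ((CompProd.assoc K.proj K.proj K.carrier ⋙
      CompProd.map K.mul K.mul_proj (𝟭 K.carrier)).map φ) ?_ ?_ ?_ ?_
    · exact mul_stdObj hK k fun i => arity_ofArity hK (k i)
    · rintro i ⟨j, hj⟩ rfl
      rfl
    · exact opMu_heq_map_stdHom hK f g (b := fun i => (d i).fst)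
        (fun i => StrictPullback.Hom.fst (s i)) (fun _ => rfl) (fun i => (hs i).1)
    · rintro i ⟨j, hj⟩ rfl
      -- The trailing `eqToHom` is the one that `joinMap` inserts.
      refine ((hs _).2 _).trans (comp_eqToHom_heq _ _).symm
  · refine (opMu_heq_map hK _ _ ((CompProd.map (𝟭 K.carrier) rfl K.mul).map φ) rfl ?_ HEq.rfl
      ?_).symm
    · rintro i ⟨j, hj⟩ rfl
      exact mul_stdObj hK (l i) fun j => arity_ofArity hK (l i j)
    · rintro i ⟨j, hj⟩ rfl
      refine opMu_heq_map hK _ _ (s i) rfl ?_ (hs i).1 ?_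
      · rintro i ⟨j, hj⟩ rfl
        rfl
      · rintro _ ⟨j, hj⟩ rfl
        exact (hs i).2 _

/-- The interchange law is functoriality of `K.mul` on φ ≫ ψ. Multiplication in `End` reverses
composition, so φ carries g' and ψ carries g. -/
lemma opMu_mul_opMu {n : ℕ} (l : Fin n → ℕ) (g g' : Op hK n) (f : ∀ i, Op hK (l i))
    (f' : ∀ i, Op hK (l (perm hK n g' i))) :
    cast (congrArg (Op hK) (Equiv.sum_comp (perm hK n g') l).symm) (opMu hK g f) *
        opMu hK g' f' =
      opMu hK (g * g') (fun i => f (perm hK n g' i) * f' i) := by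
  obtain ⟨b, t, hb, ht⟩ := exists_stdHom_heq hK g f
  have h₁ := opMu_heq_map_stdHom hK g' f' (b := fun i => ofArity hK (l i)) f'
    (fun _ => rfl) (fun _ => HEq.rfl)
  have h₂ := opMu_heq_map_stdHom hK g f t (fun _ => rfl) ht
  let φ := stdHom hK g' (fun i => ofArity hK (l (perm hK n g' i))) (fun i => ofArity hK (l i)) f'
  let ψ := stdHom hK g _ b t
  refine eq_of_heq (HEq.trans ?_ (HEq.symm (opMu_heq_map hK _ _ (φ ≫ ψ) rfl ?_ HEq.rfl ?_)))
  · rw [K.mul.map_comp]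
    have hx := mul_stdObj hK (fun i => l (perm hK n g' i)) fun i => arity_ofArity hK _
    have hy := eq_of_hom hK.1 (K.mul.map φ)
    have hz := eq_of_hom hK.1 (K.mul.map ψ)
    exact heq_comp_of_heq hx.symm (hx.symm.trans hy) (hx.symm.trans (hy.trans hz)) h₁
      ((cast_heq _ _).trans h₂)
  · rintro i ⟨j, hj⟩ rfl
    rfl
  · rintro i ⟨j, hj⟩ rfl
    exact heq_comp_of_heq rfl rfl (hb _).symm HEq.rfl (ht _)

/-- The action operad of a club that is a groupoid and bijective on objects over `BΣ`. -/
noncomputable def actionOperad [IsGroupoid K.carrier] : ActionOperad.{u} where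
  carrier := Op hK
  one := 1
  mu := opMu hK
  one_mu := one_opMu hK
  mu_one := opMu_one hK
  assoc := opMu_assoc hK
  group n :=
    { (inferInstance : Monoid (Op hK n)) with
      -- The groupoid condition turns the endomorphism monoids into groups.
      inv := fun g => inv (End.asHom g)
      inv_mul_cancel := fun g => IsIso.hom_inv_id (End.asHom g) }
  π := perm hK
  π_mu := perm_opMu hK
  mu_mul_mu := opMu_mul_opMu hK

end Club

/-! ### The isomorphism between K and the club of its action operad. -/

lemma CompProd.map_comp_map {X Y X' Y' X'' Y'' : Type u} [Category.{u} X] [Category.{u} Y]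
    [Category.{u} X'] [Category.{u} Y'] [Category.{u} X''] [Category.{u} Y'']
    {p : X ⥤ BSigma.{u}} {p' : X' ⥤ BSigma.{u}} {p'' : X'' ⥤ BSigma.{u}}
    (F : X ⥤ X') (hF : F ⋙ p' = p) (G : Y ⥤ Y') (F' : X' ⥤ X'') (hF' : F' ⋙ p'' = p')
    (G' : Y' ⥤ Y'') :
    CompProd.map F hF G ⋙ CompProd.map F' hF' G' =
      CompProd.map (F ⋙ F') (by rw [Functor.assoc, hF', hF]) (G ⋙ G') :=
  rfl

lemma CompProd.map_eq_id {X Y : Type u} [Category.{u} X] [Category.{u} Y] {p : X ⥤ BSigma.{u}}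
    {F : X ⥤ X} (hF : F ⋙ p = p) {G : Y ⥤ Y} (hF' : F = 𝟭 X) (hG : G = 𝟭 Y) :
    CompProd.map F hF G = 𝟭 (CompProd p Y) := by
  subst hF' hG
  rfl

namespace Club

/-- A morphism of clubs whose functor is invertible is an isomorphism. -/
def isoOfInverse {K L : Club.{u}} (F : K ⟶ L) (G : L.carrier ⥤ K.carrier)
    (h₁ : Hom.functor F ⋙ G = 𝟭 _) (h₂ : G ⋙ Hom.functor F = 𝟭 _) : K ≅ L where
  hom := F
  inv :=
    { functor := G
      proj := by rw [← Hom.proj F, ← Functor.assoc, h₂]; rfl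
      one := by rw [← Hom.one F, Functor.assoc, h₁]; rfl
      mul := by
        have hG : G ⋙ K.proj = L.proj := by rw [← Hom.proj F, ← Functor.assoc, h₂]; rfl
        -- The compatibility of F with multiplication is precomposed with G ∘ G and postcomposed
        -- with G; the composites of F and G then cancel.
        have h := congrArg (fun H => CompProd.map G hG G ⋙ H ⋙ G) (Hom.mul F)
        simp only [← Functor.assoc, CompProd.map_comp_map] at h
        rw [CompProd.map_eq_id _ h₂ h₂, Functor.assoc, h₁] at h
        exact h.symm }
  hom_inv_id := Hom.ext h₁
  inv_hom_id := Hom.ext h₂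

variable {K : Club.{u}} (hK : Function.Bijective K.proj.obj) [IsGroupoid K.carrier]

/-- The functor that identifies `B` of the action operad of `K` with `K`. -/
noncomputable def fromBCat : BCat (actionOperad hK) ⥤ K.carrier where
  obj m := ofArity hK m.arity
  map {m n} f := End.asHom (BCat.Hom.val (m := m) (n := n) f) ≫
    eqToHom (congrArg (ofArity hK) (BCat.Hom.eq (m := m) (n := n) f))
  map_id m := Category.comp_id _
  map_comp {m n p} f g := by
    obtain ⟨m⟩ := m
    obtain ⟨n⟩ := n
    obtain ⟨p⟩ := p
    obtain ⟨e, f⟩ := f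
    obtain ⟨e', g⟩ := g
    obtain rfl : m = n := e
    obtain rfl : m = p := e'
    simp only [eqToHom_refl, Category.comp_id]
    rfl

lemma fromBCat_map_heq {m n : BCat (actionOperad hK)} (f : m ⟶ n) :
    HEq ((fromBCat hK).map f) (BCat.Hom.val f) :=
  comp_eqToHom_heq _ _

lemma fromBCat_proj : fromBCat hK ⋙ K.proj = BCat.proj (actionOperad hK) := by
  refine CategoryTheory.Functor.hext (fun x => proj_ofArity hK x.arity) fun x y f => ?_
  obtain ⟨m⟩ := x
  obtain ⟨n⟩ := y
  obtain ⟨e, g⟩ := f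
  obtain rfl : m = n := e
  refine (K.proj.map_heq_of_heq (f' := End.asHom g) rfl rfl (comp_eqToHom_heq _ _)).trans ?_
  refine ((conj_eqToHom_iff_heq' _ _ (proj_ofArity hK m).symm (proj_ofArity hK m)).1 ?_).symm
  exact BSigma.hom_ext rfl

/-- On objects the two sides have the same arity. On morphisms the left side is an `opMu` by
construction, which `opMu_heq_map` compares with the right. -/
lemma fromBCat_mul :
    BCat.mul (actionOperad hK) ⋙ fromBCat hK =
      CompProd.map (fromBCat hK) (fromBCat_proj hK) (fromBCat hK) ⋙ K.mul := by
  have h : ∀ x : CompProd (BCat.proj (actionOperad hK)) (BCat (actionOperad hK)),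
      (BCat.mul (actionOperad hK) ⋙ fromBCat hK).obj x =
        (CompProd.map (fromBCat hK) (fromBCat_proj hK) (fromBCat hK) ⋙ K.mul).obj x := fun x =>
    (eq_ofArity hK ((K.arity_mul ((CompProd.map (fromBCat hK) (fromBCat_proj hK)
      (fromBCat hK)).obj x)).trans
      (Finset.sum_congr rfl fun i _ => arity_ofArity hK (x.snd.obj i).arity))).symm
  refine CategoryTheory.Functor.hext h fun x y f => ?_
  obtain ⟨n, k, rfl⟩ := BCat.exists_stdObj x
  refine (fromBCat_map_heq hK _).trans ?_
  refine opMu_heq_map hK _ _ ((CompProd.map (fromBCat hK) (fromBCat_proj hK)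
    (fromBCat hK)).map f) rfl ?_ (fromBCat_map_heq hK _).symm ?_
  · rintro i ⟨j, hj⟩ rfl
    rfl
  · rintro i ⟨j, hj⟩ rfl
    exact (fromBCat_map_heq hK _).symm

/-- The inverse of `fromBCat`. -/
noncomputable def toBCat : K.carrier ⥤ BCat (actionOperad hK) where
  obj x := ⟨K.arity x⟩
  map {x y} f := ⟨ESigma.len_eq_of_hom (K.proj.map f),
    End.of (eqToHom (eq_ofArity hK rfl).symm ≫ f ≫
      eqToHom ((eq_of_hom hK.1 f).symm.trans (eq_ofArity hK rfl)))⟩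
  map_id x := BCat.Hom.ext (by simp; rfl)
  map_comp {x y z} f g := by
    obtain rfl := eq_of_hom hK.1 f
    obtain rfl := eq_of_hom hK.1 g
    refine BCat.Hom.ext ?_
    change eqToHom _ ≫ (f ≫ g) ≫ eqToHom _ =
      (eqToHom _ ≫ f ≫ eqToHom _) ≫ (eqToHom _ ≫ g ≫ eqToHom _)
    simp

lemma toBCat_comp_fromBCat : toBCat hK ⋙ fromBCat hK = 𝟭 _ :=
  CategoryTheory.Functor.hext (fun _ => (eq_ofArity hK rfl).symm) fun _ _ f =>
    (fromBCat_map_heq hK _).trans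
      ((conj_eqToHom_iff_heq' _ _ (eq_ofArity hK rfl).symm
        ((eq_of_hom hK.1 f).symm.trans (eq_ofArity hK rfl))).1 rfl)

lemma fromBCat_comp_toBCat : fromBCat hK ⋙ toBCat hK = 𝟭 _ :=
  BCat.heq_ext (fun x => arity_ofArity hK x.arity) fun f =>
    ((conj_eqToHom_iff_heq' _ _ _ _).1 rfl).trans (fromBCat_map_heq hK f)

/-- A club that is a groupoid and bijective on objects over `BΣ` is the club of an action operad. -/
noncomputable def isoClub : K ≅ (actionOperad hK).club :=
  (isoOfInverse (K := (actionOperad hK).club) (L := K)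
    { functor := fromBCat hK
      proj := fromBCat_proj hK
      one := CategoryTheory.Functor.hext (fun x => (one_obj hK x).symm)
        fun _ _ f => (fromBCat_map_heq hK _).trans (id_heq_one_map hK f)
      mul := fromBCat_mul hK }
    (toBCat hK) (fromBCat_comp_toBCat hK) (toBCat_comp_fromBCat hK)).symm

end Club

/-! ### Full faithfulness. -/

namespace BCat

variable {Λ Λ' : ActionOperad.{u}}

lemma val_heq_of_heq {m n m' n' : BCat Λ} {a : m ⟶ n} {b : m' ⟶ n'} (hm : m = m') (hn : n = n')
    (h : HEq a b) : HEq (Hom.val a) (Hom.val b) := by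
  subst hm hn
  obtain rfl := eq_of_heq h
  rfl

lemma hom_heq {m n m' n' : BCat Λ} {a : m ⟶ n} {b : m' ⟶ n'} (hm : m = m') (hn : n = n')
    (h : HEq (Hom.val a) (Hom.val b)) : HEq a b := by
  subst hm hn
  exact heq_of_eq (Hom.ext (eq_of_heq h))

/-- The endomorphism of `n` given by an `n`-ary operation. -/
abbrev ofOp {n : ℕ} (g : Λ.carrier n) : (⟨n⟩ : BCat Λ) ⟶ ⟨n⟩ := ⟨rfl, g⟩

end BCat

namespace ActionOperad

variable {Λ Λ' : ActionOperad.{u}} (F : Λ.club ⟶ Λ'.club)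

/-- F lies over BΣ, hence preserves arities, and an object of BΛ' is its arity. -/
lemma club_functor_obj (m : BCat Λ) : (Club.Hom.functor F).obj m = (⟨m.arity⟩ : BCat Λ') :=
  BCat.ext (congrArg ESigma.len (Functor.congr_obj (Club.Hom.proj F) m))

lemma carrier_club_functor_obj (n : ℕ) :
    Λ'.carrier (BCat.arity (Λ := Λ') ((Club.Hom.functor F).obj (⟨n⟩ : BCat Λ))) =
      Λ'.carrier n :=
  congrArg (fun m : BCat Λ' => Λ'.carrier m.arity) (club_functor_obj F ⟨n⟩)

/-- The effect of a morphism of clubs on operations. -/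
def opMap (n : ℕ) (g : Λ.carrier n) : Λ'.carrier n :=
  cast (carrier_club_functor_obj F n)
    (BCat.Hom.val (Λ := Λ') ((Club.Hom.functor F).map (BCat.ofOp g)))

lemma ofOp_opMap (n : ℕ) (g : Λ.carrier n) :
    HEq (BCat.ofOp (opMap F n g)) ((Club.Hom.functor F).map (BCat.ofOp g)) :=
  BCat.hom_heq (club_functor_obj F _).symm (club_functor_obj F _).symm (cast_heq _ _)

lemma val_map_heq {m n : BCat Λ} (f : m ⟶ n) :
    HEq (BCat.Hom.val (Λ := Λ') ((Club.Hom.functor F).map f))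
      (opMap F m.arity (BCat.Hom.val f)) := by
  obtain ⟨m⟩ := m
  obtain ⟨n⟩ := n
  obtain ⟨e, g⟩ := f
  obtain rfl : m = n := e
  exact (cast_heq _ _).symm

lemma opMap_one (n : ℕ) : opMap F n 1 = 1 := by
  have h := club_functor_obj F ⟨n⟩
  have e : HEq (𝟙 ((Club.Hom.functor F).obj (⟨n⟩ : BCat Λ))) (𝟙 (⟨n⟩ : BCat Λ')) := by
    rw [h]
    rfl
  exact congrArg BCat.Hom.val (eq_of_heq ((ofOp_opMap F n 1).trans
    ((heq_of_eq ((Club.Hom.functor F).map_id _)).trans e)))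

lemma opMap_mul (n : ℕ) (g h : Λ.carrier n) : opMap F n (g * h) = opMap F n g * opMap F n h := by
  have e := club_functor_obj F ⟨n⟩
  refine congrArg BCat.Hom.val
    (?_ : BCat.ofOp (opMap F n (g * h)) = BCat.ofOp (opMap F n h) ≫ BCat.ofOp (opMap F n g))
  exact eq_of_heq ((ofOp_opMap F n (g * h)).trans
    ((heq_of_eq ((Club.Hom.functor F).map_comp (BCat.ofOp h) (BCat.ofOp g))).trans
      (heq_comp_of_heq e e e (ofOp_opMap F n h).symm (ofOp_opMap F n g).symm)))

/-- The operad unit is the neutral element of the group of unary operations, which `opMap`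
preserves. -/
lemma opMap_operad_one : opMap F 1 Λ.one = Λ'.one := by
  rw [BCat.one_eq_one, BCat.one_eq_one, opMap_one]

lemma π_opMap (n : ℕ) (g : Λ.carrier n) : Λ'.π n (opMap F n g) = Λ.π n g := by
  have h := (Functor.map_heq_of_heq (BCat.proj Λ') (club_functor_obj F ⟨n⟩).symm
    (club_functor_obj F ⟨n⟩).symm (ofOp_opMap F n g)).trans
    (Functor.map_heq_of_eq (Club.Hom.proj F) (BCat.ofOp g))
  exact congrArg ESigma.Hom.perm (eq_of_heq h)

lemma opMap_mu {n : ℕ} {k : Fin n → ℕ} (g : Λ.carrier n) (f : ∀ i, Λ.carrier (k i)) :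
    opMap F _ (Λ.mu g f) = Λ'.mu (opMap F n g) (fun i => opMap F (k i) (f i)) := by
  -- With k of the form l (π(g)(i)), the tuple (g; f) is literally a morphism of the composition
  -- product with target list l.
  obtain ⟨l, rfl⟩ := Club.exists_comp_eq (Λ.π n g) k
  let φ := BCat.stdHom g (fun i => (⟨l (Λ.π n g i)⟩ : BCat Λ)) (fun i => ⟨l i⟩)
    (fun i => BCat.ofOp (f i))
  have e := Functor.map_heq_of_eq (Club.Hom.mul F) φ
  have h : ∀ x, _ := Functor.congr_obj (Club.Hom.mul F)
  have e' := BCat.val_heq_of_heq (h _) (h _) e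
  refine eq_of_heq (HEq.trans ?_ (e'.trans ?_))
  · exact (val_map_heq F (BCat.mulMap φ)).symm
  · refine BCat.mu_heq ?_ ?_ ?_ ?_
    · rfl
    · exact heq_of_eq (funext fun i => congrArg BCat.arity (club_functor_obj F _))
    · exact (cast_heq _ _).trans (val_map_heq F _)
    · exact Function.hfunext rfl fun i j hij => by
        obtain rfl := eq_of_heq hij
        exact val_map_heq F _

/-- The morphism of action operads that underlies a morphism of their clubs. -/
def homOfClubHom : Λ ⟶ Λ' where
  toFun n :=
    { toFun := opMap F n
      map_one' := opMap_one F n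
      map_mul' := opMap_mul F n }
  map_one := opMap_operad_one F
  map_mu := opMap_mu F
  π_comp := π_opMap F

/-- A morphism of clubs is determined by its functor, and a functor into BΛ' by its arities and
values. -/
lemma clubFunctor_map_homOfClubHom : clubFunctor.map (homOfClubHom F) = F :=
  Club.Hom.ext (BCat.heq_ext
    (fun m => congrArg BCat.arity (club_functor_obj F m).symm)
    fun f => (val_map_heq F f).symm)

end ActionOperad

theorem mainTheorem2 :
    (∀ K : Club.{u}, Function.Bijective K.proj.obj → IsGroupoid K.carrier →
      ∃ Λ : ActionOperad.{u}, Nonempty (K ≅ clubFunctor.obj Λ)) ∧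
    clubFunctor.{u}.Full ∧ clubFunctor.{u}.Faithful := by
  refine ⟨fun K hK _ => ⟨Club.actionOperad hK, ⟨Club.isoClub hK⟩⟩,
    ⟨fun F => ⟨ActionOperad.homOfClubHom F, ActionOperad.clubFunctor_map_homOfClubHom F⟩⟩,
    ⟨fun {Λ Λ' F G} h => ?_⟩⟩
  -- Faithfulness: the value at an operation g is recovered by applying the functor to g as an
  -- endomorphism in BΛ.
  refine ActionOperad.Hom.ext (funext fun n => MonoidHom.ext fun g => ?_)
  exact eq_of_heq (BCat.val_heq_of_heq rfl rfl
    (Functor.map_heq_of_eq (congrArg Club.Hom.functor h) (BCat.ofOp g)))
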